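/- Let $\mathbf V$ be a smooth $(n+m)$-dimensional manifold with an atlas of local coordinates $u=(x^i,y^a)$ whose transition maps have the form $x'=x'(x)$, $y'=y'(x,y)$, let $v\mathbf V\subset T\mathbf V$ be the subbundle spanned by the $\partial/\partial y^a$, and let $\mathbf N\colon T\mathbf V\to v\mathbf V$ be an N-connection, i.e. a smooth bundle morphism that is the identity on $v\mathbf V$; put $h\mathbf V=\ker\mathbf N$ and $\mathbf N(\partial/\partial x^i)=N_i^a\,\partial/\partial y^a$. The N-adapted frame and coframe are $e_i=\frac{\delta}{\partial x^i}=\frac{\partial}{\partial x^i}-N_i^a\frac{\partial}{\partial y^a}$, $e_a=\frac{\partial}{\partial y^a}$ and $\vartheta^i=dx^i$, $\vartheta^a=\delta y^a=dy^a+N_i^a\,dx^i$, and $\delta f=dx^i\frac{\delta f}{\partial x^i}+\delta y^a\frac{\partial f}{\partial y^a}$. Let $\mathbf g=g_{ij}\,dx^i\otimes dx^j+h_{ab}\,\delta y^a\otimes\delta y^b$ be a smooth Riemannian d-metric (so $h\mathbf V\perp v\mathbf V$), and let $\widehat{\mathbf D}$ be its canonical d-connection, $\widehat{\mathbf D}_{e_\mu}e_\beta=\widehat\Gamma^\alpha_{\beta\mu}e_\alpha$,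 whose only non-zero coefficients are $$\widehat L^i_{jk}=\tfrac12 g^{ir}(e_kg_{jr}+e_jg_{kr}-e_rg_{jk}),\qquad \widehat L^a_{bk}=e_bN_k^a+\tfrac12h^{ac}\big(e_kh_{bc}-(e_bN_k^d)h_{dc}-(e_cN_k^d)h_{db}\big),$$ $$\widehat C^i_{jc}=\tfrac12 g^{ik}e_cg_{jk},\qquad \widehat C^a_{bc}=\tfrac12h^{ad}(e_ch_{bd}+e_bh_{cd}-e_dh_{bc}).$$ Let $\mathbf V$ be equipped with a spin structure adapted to $\mathbf N$ and $\mathbf g$: local smooth orthonormal frames $e_{\hat\alpha}=(e_{\hat i},e_{\hat a})$ with $e_{\hat i}\in h\mathbf V$, $e_{\hat a}\in v\mathbf V$, over an open cover, and a smooth cocycle, with values in the subgroup of the spin group generated by products of two horizontal or of two vertical unit vectors, that lifts the changes of frame. Let $\mathbf S$ be the associated bundle of complex spinors of rank $2^{\lfloor (n+m)/2\rfloor}$, with constant self-adjoint matrices $\gamma^{\hat\alpha}$, $\gamma^{\hat\alpha}\gamma^{\hat\beta}+\gamma^{\hat\beta}\gamma^{\hat\alpha}=2\delta^{\hat\alpha\hat\beta}$.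 For a complex covector $a$ let $^{-}c(a)=\sum_{\hat i}a(e_{\hat i})\gamma^{\hat i}$, $^{\star}c(a)=\sum_{\hat a}a(e_{\hat a})\gamma^{\hat a}$, $\mathbf c(a)={}^{-}c(a)+{}^{\star}c(a)$ be the Clifford actions and $^{-}\widehat c,{}^{\star}\widehat c,\widehat{\mathbf c}$ the corresponding contractions $\mathbf S\otimes T^*\mathbf V\to\mathbf S$, $\psi\otimes a\mapsto c(a)\psi$. The canonical spin d-connection is, in these frames, $\widehat\nabla^{\mathbf S}_X\psi=X(\psi)-\frac14\sum_{\hat\alpha,\hat\beta}\mathbf g(e_{\hat\alpha},\widehat{\mathbf D}_Xe_{\hat\beta})\,\gamma^{\hat\beta}\gamma^{\hat\alpha}\psi$, and the canonical Dirac d-operator and its h- and v-parts are $$\widehat{\mathbb D}=-i\,\widehat{\mathbf c}\circ\widehat\nabla^{\mathbf S},\qquad {}^{-}\widehat{\mathbb D}=-i\,{}^{-}\widehat c\circ\widehat\nabla^{\mathbf S},\qquad {}^{\star}\widehat{\mathbb D}=-i\,{}^{\star}\widehat c\circ\widehat\nabla^{\mathbf S}.$$ Then for every smooth function $f\colon\mathbf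 V\to\mathbb C$, as operators on the smooth sections of $\mathbf S$, $$[\widehat{\mathbb D},f]=-i\,\mathbf c(\delta f),$$ and equivalently, in every coordinate chart $(x,y)$ of the atlas, $$[{}^{-}\widehat{\mathbb D},f]+[{}^{\star}\widehat{\mathbb D},f]=-i\,{}^{-}c\Big(dx^i\frac{\delta f}{\partial x^i}\Big)-i\,{}^{\star}c\Big(\delta y^a\frac{\partial f}{\partial y^a}\Big).$$ -/

import Mathlib

open Set Bundle Manifold
open scoped ContDiff

noncomputable section

namespace NAnholonomic

/-! ### Fibred manifolds, N-connections and N-adapted frames -/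

/-- The model space `ℝⁿ × ℝᵐ` of the local coordinates `u = (x, y)`. -/
abbrev Model (n m : ℕ) : Type := EuclideanSpace ℝ (Fin n) × EuclideanSpace ℝ (Fin m)

/-- The index set of the indices `α = (i, a)`: `Sum.inl i` is an h-index, `Sum.inr a` a v-index. -/
abbrev Idx (n m : ℕ) : Type := Fin n ⊕ Fin m

/-- A smooth manifold of dimension `n + m` with an atlas of coordinates `(x, y)` whose transition
maps are of the form `x' = x'(x)`, `y' = y'(x, y)`, i.e. `∂x'/∂y = 0`. -/
class IsFibredManifold (n m : ℕ) (V : Type*) [TopologicalSpace V]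
    [ChartedSpace (Model n m) V] : Prop extends IsManifold 𝓘(ℝ, Model n m) ∞ V where
  fst_fderiv_vertical : ∀ e ∈ atlas (Model n m) V, ∀ e' ∈ atlas (Model n m) V,
    ∀ p ∈ (e.symm ≫ₕ e').source, ∀ w : EuclideanSpace ℝ (Fin m),
      (fderiv ℝ (e.symm ≫ₕ e') p (0, w)).1 = 0

section Coordinates

variable {n m : ℕ} {V : Type*} [TopologicalSpace V] [ChartedSpace (Model n m) V]

/-- The coordinate vector field `∂/∂xⁱ` of the chart `φ`. -/
def coordX (φ : OpenPartialHomeomorph V (Model n m)) (i : Fin n) (u : V) :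
    TangentSpace 𝓘(ℝ, Model n m) u :=
  mfderiv 𝓘(ℝ, Model n m) 𝓘(ℝ, Model n m) φ.symm (φ u)
    ((EuclideanSpace.single i (1 : ℝ), 0) : Model n m)

/-- The coordinate vector field `∂/∂yᵃ` of the chart `φ`. -/
def coordY (φ : OpenPartialHomeomorph V (Model n m)) (a : Fin m) (u : V) :
    TangentSpace 𝓘(ℝ, Model n m) u :=
  mfderiv 𝓘(ℝ, Model n m) 𝓘(ℝ, Model n m) φ.symm (φ u)
    ((0, EuclideanSpace.single a (1 : ℝ)) : Model n m)

/-- The coordinate differential `dxⁱ` of the chart `φ`. -/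
def coordDX (φ : OpenPartialHomeomorph V (Model n m)) (i : Fin n) (u : V) :
    TangentSpace 𝓘(ℝ, Model n m) u →L[ℝ] ℝ :=
  (EuclideanSpace.proj i ∘L ContinuousLinearMap.fst ℝ _ _) ∘L
    mfderiv 𝓘(ℝ, Model n m) 𝓘(ℝ, Model n m) φ u

/-- The coordinate differential `dyᵃ` of the chart `φ`. -/
def coordDY (φ : OpenPartialHomeomorph V (Model n m)) (a : Fin m) (u : V) :
    TangentSpace 𝓘(ℝ, Model n m) u →L[ℝ] ℝ :=
  (EuclideanSpace.proj a ∘L ContinuousLinearMap.snd ℝ _ _) ∘L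
    mfderiv 𝓘(ℝ, Model n m) 𝓘(ℝ, Model n m) φ u

/-- The vertical subspace `vV_u`: the tangent vectors whose `x`-components vanish. -/
def vertical (n m : ℕ) {V : Type*} [TopologicalSpace V] [ChartedSpace (Model n m) V] (u : V) :
    Submodule ℝ (TangentSpace 𝓘(ℝ, Model n m) u) :=
  LinearMap.ker (ContinuousLinearMap.fst ℝ (EuclideanSpace ℝ (Fin n)) (EuclideanSpace ℝ (Fin m)) ∘L
    mfderiv 𝓘(ℝ, Model n m) 𝓘(ℝ, Model n m) (chartAt (Model n m) u) u).toLinearMap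

end Coordinates

/-- An N-connection: a smooth bundle morphism `N : TV → vV` that is the identity on `vV`. -/
structure NConnection (n m : ℕ) (V : Type*) [TopologicalSpace V]
    [ChartedSpace (Model n m) V] [IsFibredManifold n m V] where
  toFun : ∀ u : V, TangentSpace 𝓘(ℝ, Model n m) u →L[ℝ] TangentSpace 𝓘(ℝ, Model n m) u
  mem_vertical : ∀ u X, toFun u X ∈ vertical n m u
  apply_vertical : ∀ u, ∀ X ∈ vertical n m u, toFun u X = X
  smooth : ContMDiff 𝓘(ℝ, Model n m) (𝓘(ℝ, Model n m).prod 𝓘(ℝ, Model n m →L[ℝ] Model n m)) ∞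
    (fun u : V ↦ TotalSpace.mk' (Model n m →L[ℝ] Model n m)
      (E := fun u : V ↦ TangentSpace 𝓘(ℝ, Model n m) u →L[ℝ] TangentSpace 𝓘(ℝ, Model n m) u)
      u (toFun u))

section NAdapted

variable {n m : ℕ} {V : Type*} [TopologicalSpace V] [ChartedSpace (Model n m) V]
  [IsFibredManifold n m V]

/-- The coefficients `Nᵢᵃ` of the N-connection in the chart `φ`: `N(∂/∂xⁱ) = Nᵢᵃ ∂/∂yᵃ`. -/
def NConnection.coeff (N : NConnection n m V) (φ : OpenPartialHomeomorph V (Model n m))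
    (i : Fin n) (a : Fin m) (u : V) : ℝ :=
  coordDY φ a u (N.toFun u (coordX φ i u))

/-- The N-adapted frame `eᵢ = ∂/∂xⁱ - Nᵢᵃ ∂/∂yᵃ`, `e_a = ∂/∂yᵃ`. -/
def NConnection.frame (N : NConnection n m V) (φ : OpenPartialHomeomorph V (Model n m)) :
    Idx n m → ∀ u : V, TangentSpace 𝓘(ℝ, Model n m) u
  | .inl i, u => coordX φ i u - ∑ a, N.coeff φ i a u • coordY φ a u
  | .inr a, u => coordY φ a u

/-- The dual N-adapted coframe `ϑⁱ = dxⁱ`, `ϑᵃ = δyᵃ = dyᵃ + Nᵢᵃ dxⁱ`. -/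
def NConnection.coframe (N : NConnection n m V) (φ : OpenPartialHomeomorph V (Model n m)) :
    Idx n m → ∀ u : V, TangentSpace 𝓘(ℝ, Model n m) u →L[ℝ] ℝ
  | .inl i, u => coordDX φ i u
  | .inr a, u => coordDY φ a u + ∑ i, N.coeff φ i a u • coordDX φ i u

/-- The derivative `X(F)` of a vector-valued function along a tangent vector `X` at `u`. -/
def lieDeriv {W : Type*} [NormedAddCommGroup W] [NormedSpace ℝ W] (F : V → W) (u : V)
    (X : TangentSpace 𝓘(ℝ, Model n m) u) : W :=
  mfderiv 𝓘(ℝ, Model n m) 𝓘(ℝ, W) F u X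

/-- The N-elongated partial derivatives of a function:
`δF/∂xⁱ = ∂F/∂xⁱ - Nᵢᵃ ∂F/∂yᵃ` for an h-index and `∂F/∂yᵃ` for a v-index. -/
def NConnection.partialDeriv (N : NConnection n m V) (φ : OpenPartialHomeomorph V (Model n m))
    {W : Type*} [NormedAddCommGroup W] [NormedSpace ℝ W] (F : V → W) : Idx n m → V → W
  | .inl i, u => lieDeriv F u (coordX φ i u)
      - ∑ a, N.coeff φ i a u • lieDeriv F u (coordY φ a u)
  | .inr a, u => lieDeriv F u (coordY φ a u)

/-- The N-elongated h-differential `dxⁱ δf/∂xⁱ` of a complex function, in the chart `φ`. -/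
def NConnection.hDifferential (N : NConnection n m V)
    (φ : OpenPartialHomeomorph V (Model n m)) (f : V → ℂ) (u : V) :
    TangentSpace 𝓘(ℝ, Model n m) u →L[ℝ] ℂ :=
  ∑ i : Fin n, (N.coframe φ (.inl i) u).smulRight (N.partialDeriv φ f (.inl i) u)

/-- The N-elongated v-differential `δyᵃ ∂f/∂yᵃ` of a complex function, in the chart `φ`. -/
def NConnection.vDifferential (N : NConnection n m V)
    (φ : OpenPartialHomeomorph V (Model n m)) (f : V → ℂ) (u : V) :
    TangentSpace 𝓘(ℝ, Model n m) u →L[ℝ] ℂ :=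
  ∑ a : Fin m, (N.coframe φ (.inr a) u).smulRight (N.partialDeriv φ f (.inr a) u)

/-- The N-adapted absolute differential `δf = dxⁱ δf/∂xⁱ + δyᵃ ∂f/∂yᵃ`. -/
def NConnection.differential (N : NConnection n m V) (f : V → ℂ) (u : V) :
    TangentSpace 𝓘(ℝ, Model n m) u →L[ℝ] ℂ :=
  N.hDifferential (chartAt (Model n m) u) f u + N.vDifferential (chartAt (Model n m) u) f u

/-! ### d-metrics and the canonical d-connection -/

/-- A (Riemannian) d-metric `g = g_{ij} ϑⁱ ⊗ ϑʲ + h_{ab} ϑᵃ ⊗ ϑᵇ`: a Riemannian metric for which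
`hV = ker N` and `vV` are orthogonal. -/
structure DMetric (N : NConnection n m V) extends
    ContMDiffRiemannianMetric 𝓘(ℝ, Model n m) ∞ (Model n m)
      (fun u : V ↦ TangentSpace 𝓘(ℝ, Model n m) u) where
  orthogonal : ∀ (u : V) (X Y : TangentSpace 𝓘(ℝ, Model n m) u),
    N.toFun u X = 0 → Y ∈ vertical n m u → inner u X Y = 0

variable {N : NConnection n m V}

/-- The coefficients `g_{ij} = g(eᵢ, eⱼ)`. -/
def DMetric.hCoeff (g : DMetric N) (φ : OpenPartialHomeomorph V (Model n m)) (i j : Fin n)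
    (u : V) : ℝ :=
  g.inner u (N.frame φ (.inl i) u) (N.frame φ (.inl j) u)

/-- The coefficients `h_{ab} = g(e_a, e_b)`. -/
def DMetric.vCoeff (g : DMetric N) (φ : OpenPartialHomeomorph V (Model n m)) (a b : Fin m)
    (u : V) : ℝ :=
  g.inner u (N.frame φ (.inr a) u) (N.frame φ (.inr b) u)

/-- The inverse matrix `g^{ij}`. -/
def DMetric.hInv (g : DMetric N) (φ : OpenPartialHomeomorph V (Model n m)) (u : V) :
    Matrix (Fin n) (Fin n) ℝ :=
  (Matrix.of fun i j ↦ g.hCoeff φ i j u)⁻¹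

/-- The inverse matrix `h^{ab}`. -/
def DMetric.vInv (g : DMetric N) (φ : OpenPartialHomeomorph V (Model n m)) (u : V) :
    Matrix (Fin m) (Fin m) ℝ :=
  (Matrix.of fun a b ↦ g.vCoeff φ a b u)⁻¹

/-- The N-adapted coefficients `Γ^α_{βμ}` of the canonical d-connection in the chart `φ`, i.e.
`D_{e_μ} e_β = Γ^α_{βμ} e_α`; they are, in the order of the clauses,
`L^i_{jk}`, `L^a_{bk}`, `C^i_{jc}`, `C^a_{bc}`. -/
def DMetric.Gamma (g : DMetric N) (φ : OpenPartialHomeomorph V (Model n m)) :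
    Idx n m → Idx n m → Idx n m → V → ℝ
  | .inl i, .inl j, .inl k, u => 1 / 2 * ∑ r, g.hInv φ u i r *
      (N.partialDeriv φ (g.hCoeff φ j r) (.inl k) u + N.partialDeriv φ (g.hCoeff φ k r) (.inl j) u
        - N.partialDeriv φ (g.hCoeff φ j k) (.inl r) u)
  | .inr a, .inr b, .inl k, u => N.partialDeriv φ (N.coeff φ k a) (.inr b) u +
      1 / 2 * ∑ c, g.vInv φ u a c *
        (N.partialDeriv φ (g.vCoeff φ b c) (.inl k) u
          - ∑ d, N.partialDeriv φ (N.coeff φ k d) (.inr b) u * g.vCoeff φ d c u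
          - ∑ d, N.partialDeriv φ (N.coeff φ k d) (.inr c) u * g.vCoeff φ d b u)
  | .inl i, .inl j, .inr c, u => 1 / 2 * ∑ k, g.hInv φ u i k *
      N.partialDeriv φ (g.hCoeff φ j k) (.inr c) u
  | .inr a, .inr b, .inr c, u => 1 / 2 * ∑ d, g.vInv φ u a d *
      (N.partialDeriv φ (g.vCoeff φ b d) (.inr c) u + N.partialDeriv φ (g.vCoeff φ c d) (.inr b) u
        - N.partialDeriv φ (g.vCoeff φ b c) (.inr d) u)
  | .inl _, .inr _, _, _ => 0
  | .inr _, .inl _, _, _ => 0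

/-- The canonical d-connection: the covariant derivative
`D_X Y = (X(Y^α) + Γ^α_{βμ} Y^β X^μ) e_α` at `u` of a vector field `Y` along `X ∈ T_u V`,
computed in the preferred chart at `u`. -/
def DMetric.canonicalDConnection (g : DMetric N) (Y : ∀ u : V, TangentSpace 𝓘(ℝ, Model n m) u)
    (u : V) (X : TangentSpace 𝓘(ℝ, Model n m) u) : TangentSpace 𝓘(ℝ, Model n m) u :=
  let φ := chartAt (Model n m) u
  ∑ α, (lieDeriv (fun v ↦ N.coframe φ α v (Y v)) u X
    + ∑ β, ∑ μ, g.Gamma φ α β μ u * N.coframe φ β u (Y u) * N.coframe φ μ u X) • N.frame φ α u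

end NAdapted

/-! ### N-anholonomic spin structures and spinor fields -/

/-- The typical fibre of the spinor bundle, of the dimension `2^⌊(n + m)/2⌋` of an irreducible
representation of the complex Clifford algebra (of its even part in odd dimensions). -/
abbrev Spinor (n m : ℕ) : Type := EuclideanSpace ℂ (Fin (2 ^ ((n + m) / 2)))

/-- Self-adjoint d-gamma matrices with `γ^α γ^β + γ^β γ^α = 2 δ^{αβ}`. -/
structure DGamma (n m : ℕ) where
  toFun : Idx n m → Spinor n m →L[ℂ] Spinor n m
  selfAdjoint : ∀ α, IsSelfAdjoint (toFun α)
  anticomm : ∀ α β, toFun α * toFun β + toFun β * toFun α = if α = β then 2 else 0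

/-- The spin d-group, as a group of operators on spinors: it is generated by the products of two
horizontal, or of two vertical, unit vectors. -/
def DGamma.spinDGroup {n m : ℕ} (γ : DGamma n m) :
    Submonoid (Spinor n m →L[ℂ] Spinor n m) :=
  Submonoid.closure
    ({s | ∃ w w' : EuclideanSpace ℝ (Fin n), ‖w‖ = 1 ∧ ‖w'‖ = 1 ∧
        s = (∑ i, (w i : ℂ) • γ.toFun (.inl i)) * (∑ i, (w' i : ℂ) • γ.toFun (.inl i))} ∪
      {s | ∃ w w' : EuclideanSpace ℝ (Fin m), ‖w‖ = 1 ∧ ‖w'‖ = 1 ∧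
        s = (∑ a, (w a : ℂ) • γ.toFun (.inr a)) * (∑ a, (w' a : ℂ) • γ.toFun (.inr a))})

/-- A spin structure on an N-anholonomic manifold with d-metric `g`: smooth orthonormal N-adapted
frames `e_α = (e_i, e_a)` (with `e_i` horizontal and `e_a` vertical) over the sets of an open cover,
together with a smooth cocycle in the spin d-group that lifts the changes of frame. -/
structure SpinStructure {n m : ℕ} {V : Type*} [TopologicalSpace V] [ChartedSpace (Model n m) V]
    [IsFibredManifold n m V] {N : NConnection n m V} (g : DMetric N) (ι : Type*) where
  gamma : DGamma n m
  baseSet : ι → Set V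
  isOpen_baseSet : ∀ κ, IsOpen (baseSet κ)
  indexAt : V → ι
  mem_baseSet_at : ∀ u, u ∈ baseSet (indexAt u)
  frame : ι → Idx n m → ∀ u : V, TangentSpace 𝓘(ℝ, Model n m) u
  smooth_frame : ∀ κ α, ContMDiffOn 𝓘(ℝ, Model n m) 𝓘(ℝ, Model n m).tangent ∞
    (fun u ↦ (⟨u, frame κ α u⟩ : TangentBundle 𝓘(ℝ, Model n m) V)) (baseSet κ)
  orthonormal : ∀ κ, ∀ u ∈ baseSet κ, ∀ α β,
    g.inner u (frame κ α u) (frame κ β u) = if α = β then 1 else 0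
  horizontal_frame : ∀ κ, ∀ u ∈ baseSet κ, ∀ i, N.toFun u (frame κ (.inl i) u) = 0
  vertical_frame : ∀ κ, ∀ u ∈ baseSet κ, ∀ a, frame κ (.inr a) u ∈ vertical n m u
  /-- `transition κ κ'` maps the components of spinors in the frame `κ` to those in `κ'`. -/
  transition : ι → ι → V → Spinor n m →L[ℂ] Spinor n m
  transition_mem : ∀ κ κ', ∀ u ∈ baseSet κ ∩ baseSet κ',
    transition κ κ' u ∈ gamma.spinDGroup
  smooth_transition : ∀ κ κ', ContMDiffOn 𝓘(ℝ, Model n m)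
    𝓘(ℝ, Spinor n m →L[ℂ] Spinor n m) ∞ (transition κ κ') (baseSet κ ∩ baseSet κ')
  transition_self : ∀ κ, ∀ u ∈ baseSet κ, transition κ κ u = 1
  transition_comp : ∀ κ κ' κ'', ∀ u ∈ baseSet κ ∩ baseSet κ' ∩ baseSet κ'',
    transition κ' κ'' u * transition κ κ' u = transition κ κ'' u
  /-- The spin cocycle covers the changes of frame: Clifford multiplication by a tangent vector
  does not depend on the frame in which it is computed. -/
  transition_clifford : ∀ κ κ', ∀ u ∈ baseSet κ ∩ baseSet κ', ∀ X,
    transition κ κ' u * (∑ α, (g.inner u X (frame κ α u) : ℂ) • gamma.toFun α) =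
      (∑ α, (g.inner u X (frame κ' α u) : ℂ) • gamma.toFun α) * transition κ κ' u

namespace SpinStructure

variable {n m : ℕ} {V : Type*} [TopologicalSpace V] [ChartedSpace (Model n m) V]
  [IsFibredManifold n m V] {N : NConnection n m V} {g : DMetric N} {ι : Type*}

/-- The d-spinor bundle `S`, glued by the spin cocycle. -/
def bundleCore (σ : SpinStructure g ι) : VectorBundleCore ℂ V (Spinor n m) ι where
  baseSet := σ.baseSet
  isOpen_baseSet := σ.isOpen_baseSet
  indexAt := σ.indexAt
  mem_baseSet_at := σ.mem_baseSet_at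
  coordChange := σ.transition
  coordChange_self κ u hu v := by rw [σ.transition_self κ u hu]; rfl
  continuousOn_coordChange κ κ' := (σ.smooth_transition κ κ').continuousOn
  coordChange_comp κ κ' κ'' u hu v := by
    rw [← σ.transition_comp κ κ' κ'' u hu]; rfl

/-- The fibre `S_u` of the d-spinor bundle. -/
abbrev Fiber (σ : SpinStructure g ι) (u : V) : Type := σ.bundleCore.Fiber u

/-- The components of an element of `S_u` in the frame `indexAt u`; this is the identity, as
`bundleCore` represents an element of `S_u` by these components. -/
def components (σ : SpinStructure g ι) {u : V} : σ.Fiber u ≃ₗ[ℂ] Spinor n m :=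
  LinearEquiv.refl ℂ (Spinor n m)

/-- Smooth d-spinor fields, i.e. elements of `Γ^∞(S)`. -/
def IsSmoothSection (σ : SpinStructure g ι) (ψ : ∀ u : V, σ.Fiber u) : Prop :=
  ContMDiff 𝓘(ℝ, Model n m) (𝓘(ℝ, Model n m).prod 𝓘(ℝ, Spinor n m)) ∞
    (fun u : V ↦ TotalSpace.mk' (Spinor n m) (E := σ.Fiber) u (ψ u))

/-- The components of a d-spinor field in the frame `κ`. -/
def localRep (σ : SpinStructure g ι) (κ : ι) (ψ : ∀ u : V, σ.Fiber u) (u : V) : Spinor n m :=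
  (σ.bundleCore.localTriv κ (TotalSpace.mk' (Spinor n m) (E := σ.Fiber) u (ψ u))).2

/-- The gamma matrices `γ^α` acting on `S_u`, relative to the frame `indexAt u`. -/
def gammaAt (σ : SpinStructure g ι) (u : V) (α : Idx n m) : σ.Fiber u →ₗ[ℂ] σ.Fiber u :=
  σ.components.symm.toLinearMap ∘ₗ (σ.gamma.toFun α).toLinearMap ∘ₗ σ.components.toLinearMap

/-- The orthonormal N-adapted frame `e_α` at `u` that belongs to `gammaAt`. -/
def frameAt (σ : SpinStructure g ι) (u : V) (α : Idx n m) : TangentSpace 𝓘(ℝ, Model n m) u :=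
  σ.frame (σ.indexAt u) α u

/-! ### The Clifford action -/

/-- The Clifford action `^{-}c(a) = a(e_i) γ^i` of (the h-part of) a complex covector. -/
def cliffordH (σ : SpinStructure g ι) {u : V} (a : TangentSpace 𝓘(ℝ, Model n m) u →L[ℝ] ℂ) :
    σ.Fiber u →ₗ[ℂ] σ.Fiber u :=
  ∑ i : Fin n, a (σ.frameAt u (.inl i)) • σ.gammaAt u (.inl i)

/-- The Clifford action `^{⋆}c(a) = a(e_b) γ^b` of (the v-part of) a complex covector. -/
def cliffordV (σ : SpinStructure g ι) {u : V} (a : TangentSpace 𝓘(ℝ, Model n m) u →L[ℝ] ℂ) :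
    σ.Fiber u →ₗ[ℂ] σ.Fiber u :=
  ∑ b : Fin m, a (σ.frameAt u (.inr b)) • σ.gammaAt u (.inr b)

/-- The Clifford action `c(a) = a(e_α) γ^α` of a complex covector. -/
def clifford (σ : SpinStructure g ι) {u : V} (a : TangentSpace 𝓘(ℝ, Model n m) u →L[ℝ] ℂ) :
    σ.Fiber u →ₗ[ℂ] σ.Fiber u :=
  ∑ α : Idx n m, a (σ.frameAt u α) • σ.gammaAt u α

/-- The contraction `ĉ : S_u ⊗ T*_u V → S_u`, `ĉ(ψ ⊗ a) = c(a) ψ`, where an element of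
`S_u ⊗ T*_u V` is given as a map `A : T_u V → S_u`. -/
def contract (σ : SpinStructure g ι) {u : V} (A : TangentSpace 𝓘(ℝ, Model n m) u → σ.Fiber u) :
    σ.Fiber u :=
  ∑ α : Idx n m, σ.gammaAt u α (A (σ.frameAt u α))

theorem contract_tmul (σ : SpinStructure g ι) {u : V} (ψ : σ.Fiber u)
    (a : TangentSpace 𝓘(ℝ, Model n m) u →L[ℝ] ℂ) :
    σ.contract (fun X ↦ a X • ψ) = σ.clifford a ψ := by
  simp [contract, clifford, LinearMap.sum_apply]

/-- The contraction `^{-}ĉ` with the h-Clifford action. -/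
def contractH (σ : SpinStructure g ι) {u : V} (A : TangentSpace 𝓘(ℝ, Model n m) u → σ.Fiber u) :
    σ.Fiber u :=
  ∑ i : Fin n, σ.gammaAt u (.inl i) (A (σ.frameAt u (.inl i)))

/-- The contraction `^{⋆}ĉ` with the v-Clifford action. -/
def contractV (σ : SpinStructure g ι) {u : V} (A : TangentSpace 𝓘(ℝ, Model n m) u → σ.Fiber u) :
    σ.Fiber u :=
  ∑ a : Fin m, σ.gammaAt u (.inr a) (A (σ.frameAt u (.inr a)))

/-! ### The canonical spin d-connection and the canonical Dirac d-operator -/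

/-- The connection coefficients `Γ_{αβ}(X) = g(e_α, D_X e_β)` of the canonical d-connection in the
orthonormal N-adapted frame at `u`. -/
def connectionForm (σ : SpinStructure g ι) (u : V) (α β : Idx n m)
    (X : TangentSpace 𝓘(ℝ, Model n m) u) : ℝ :=
  g.inner u (σ.frameAt u α) (g.canonicalDConnection (σ.frame (σ.indexAt u) β) u X)

/-- The canonical spin d-connection `∇^S_X ψ = X(ψ) - ¼ Γ^α_β(X) γ^β γ_α ψ`, computed in the
orthonormal N-adapted frame at `u`, where `D e_β = Γ^α_β e_α` for the canonical d-connection `D`. -/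
def spinDConnection (σ : SpinStructure g ι) (ψ : ∀ u : V, σ.Fiber u) (u : V)
    (X : TangentSpace 𝓘(ℝ, Model n m) u) : σ.Fiber u :=
  σ.components.symm (lieDeriv (σ.localRep (σ.indexAt u) ψ) u X)
    - (1 / 4 : ℂ) • ∑ α, ∑ β, (σ.connectionForm u α β X : ℂ) •
        σ.gammaAt u β (σ.gammaAt u α (ψ u))

/-- The canonical Dirac d-operator `D̂ = -i ĉ ∘ ∇^S`. -/
def dirac (σ : SpinStructure g ι) (ψ : ∀ u : V, σ.Fiber u) (u : V) : σ.Fiber u :=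
  -Complex.I • σ.contract (σ.spinDConnection ψ u)

/-- The h-part `^{-}D̂ = -i ^{-}ĉ ∘ ^{-}∇^S`. -/
def diracH (σ : SpinStructure g ι) (ψ : ∀ u : V, σ.Fiber u) (u : V) : σ.Fiber u :=
  -Complex.I • σ.contractH (σ.spinDConnection ψ u)

/-- The v-part `^{⋆}D̂ = -i ^{⋆}ĉ ∘ ^{⋆}∇^S`. -/
def diracV (σ : SpinStructure g ι) (ψ : ∀ u : V, σ.Fiber u) (u : V) : σ.Fiber u :=
  -Complex.I • σ.contractV (σ.spinDConnection ψ u)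

/-- The commutator `[P, f] ψ = P (f ψ) - f (P ψ)` of an operator `P` on d-spinor fields with the
multiplication by a function. -/
def commutator {σ : SpinStructure g ι}
    (P : (∀ u : V, σ.Fiber u) → ∀ u : V, σ.Fiber u) (f : V → ℂ) (ψ : ∀ u : V, σ.Fiber u) (u : V) :
    σ.Fiber u :=
  P (fun v ↦ f v • ψ v) u - f u • P ψ u

end SpinStructure

end NAnholonomic

end

/-! The commutator of a first-order operator with a function is its principal symbol. By the product
rule, `∇^S(fψ) = f ∇^S ψ + df ⊗ ψ`: the connection term is pointwise linear in `ψ`, so it commutes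
with `f` whatever its coefficients are (`spinDConnection_smul`). The Clifford contractions are
complex-linear, so in each commutator only `-i` times the contraction of `df ⊗ ψ` survives.

It remains to compare `df` with the N-elongated differentials. Their sum is `df`, because the terms
in `Nᵢᵃ` cancel (`NConnection.differential_apply`). Separately, the v-differential factors through
`N` and vanishes on `hV`, while the h-differential is built from the `dxⁱ` and vanishes on `vV`.
Each therefore agrees with `df` on its own half of the adapted orthonormal frame, which is all that
its Clifford action sees. That the `dxⁱ` of every chart of the atlas annihilate `vV` is where the
fibred form of the transition maps enters (`fst_mfderiv_eq_zero`). -/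

noncomputable section

namespace NAnholonomic

/-! ### Coordinate frames and chart independence of verticality -/

section Charts

variable {n m : ℕ} {V : Type*} [TopologicalSpace V] [ChartedSpace (Model n m) V]
  [IsFibredManifold n m V] {φ : OpenPartialHomeomorph V (Model n m)} {u : V}

theorem mdifferentiable_of_mem_atlas (hφ : φ ∈ atlas (Model n m) V) :
    φ.MDifferentiable 𝓘(ℝ, Model n m) 𝓘(ℝ, Model n m) :=
  have : IsManifold 𝓘(ℝ, Model n m) 1 V := IsManifold.of_le (n := ∞) (by norm_cast)
  _root_.mdifferentiable_of_mem_atlas hφ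

theorem mfderiv_symm_mfderiv (hφ : φ ∈ atlas (Model n m) V) (hu : u ∈ φ.source)
    (X : TangentSpace 𝓘(ℝ, Model n m) u) :
    mfderiv 𝓘(ℝ, Model n m) 𝓘(ℝ, Model n m) φ.symm (φ u)
      (mfderiv 𝓘(ℝ, Model n m) 𝓘(ℝ, Model n m) φ u X) = X :=
  DFunLike.congr_fun ((mdifferentiable_of_mem_atlas hφ).symm_comp_deriv hu) X

theorem mfderiv_mfderiv_symm (hφ : φ ∈ atlas (Model n m) V) (hu : u ∈ φ.source) (w : Model n m) :
    (mfderiv 𝓘(ℝ, Model n m) 𝓘(ℝ, Model n m) φ u :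
        TangentSpace 𝓘(ℝ, Model n m) u →L[ℝ] Model n m)
      (mfderiv 𝓘(ℝ, Model n m) 𝓘(ℝ, Model n m) φ.symm (φ u) w) = w := by
  have h := (mdifferentiable_of_mem_atlas hφ).comp_symm_deriv (φ.map_source hu)
  rw [φ.left_inv hu] at h
  exact DFunLike.congr_fun h w

theorem sum_smul_single (w : Model n m) :
    ∑ i, w.1 i • ((EuclideanSpace.single i (1 : ℝ), 0) : Model n m) +
      ∑ a, w.2 a • ((0, EuclideanSpace.single a (1 : ℝ)) : Model n m) = w := by
  ext j
  · simp [Prod.fst_sum, Pi.single_apply]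
  · simp [Prod.snd_sum, Pi.single_apply]

/-- A tangent vector is the combination of the coordinate vector fields with the values of the
coordinate differentials as coefficients. -/
theorem sum_coordD_smul_coord (hφ : φ ∈ atlas (Model n m) V) (hu : u ∈ φ.source)
    (X : TangentSpace 𝓘(ℝ, Model n m) u) :
    ∑ i, coordDX φ i u X • coordX φ i u + ∑ a, coordDY φ a u X • coordY φ a u = X := by
  let A : Model n m →L[ℝ] Model n m :=
    mfderiv 𝓘(ℝ, Model n m) 𝓘(ℝ, Model n m) φ.symm (φ u)
  let w : Model n m := mfderiv 𝓘(ℝ, Model n m) 𝓘(ℝ, Model n m) φ u X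
  have h : A (∑ i, w.1 i • ((EuclideanSpace.single i (1 : ℝ), 0) : Model n m) +
      ∑ a, w.2 a • ((0, EuclideanSpace.single a (1 : ℝ)) : Model n m)) = A w :=
    congrArg A (sum_smul_single w)
  rw [map_add, map_sum, map_sum] at h
  simp only [map_smul] at h
  exact h.trans (mfderiv_symm_mfderiv hφ hu X)

theorem mfderiv_coordY (hφ : φ ∈ atlas (Model n m) V) (hu : u ∈ φ.source) (a : Fin m) :
    (mfderiv 𝓘(ℝ, Model n m) 𝓘(ℝ, Model n m) φ u :
        TangentSpace 𝓘(ℝ, Model n m) u →L[ℝ] Model n m) (coordY φ a u) =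
      (0, EuclideanSpace.single a (1 : ℝ)) :=
  mfderiv_mfderiv_symm hφ hu _

theorem coordDX_coordY (hφ : φ ∈ atlas (Model n m) V) (hu : u ∈ φ.source) (i : Fin n)
    (a : Fin m) : coordDX φ i u (coordY φ a u) = 0 :=
  congrArg (fun w : Model n m ↦ w.1 i) (mfderiv_coordY hφ hu a)

theorem coordDY_coordY (hφ : φ ∈ atlas (Model n m) V) (hu : u ∈ φ.source) (a b : Fin m) :
    coordDY φ b u (coordY φ a u) = if b = a then 1 else 0 :=
  (congrArg (fun w : Model n m ↦ w.2 b) (mfderiv_coordY hφ hu a)).trans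
    (by simp)

/-- The `x`-components with respect to a chart of a vector whose `x`-components vanish in another
chart vanish. -/
theorem fst_mfderiv_eq_zero {φ' : OpenPartialHomeomorph V (Model n m)}
    (hφ : φ ∈ atlas (Model n m) V) (hφ' : φ' ∈ atlas (Model n m) V)
    (hu : u ∈ φ.source) (hu' : u ∈ φ'.source) {X : TangentSpace 𝓘(ℝ, Model n m) u}
    (hX : (mfderiv 𝓘(ℝ, Model n m) 𝓘(ℝ, Model n m) φ u X : Model n m).1 = 0) :
    (mfderiv 𝓘(ℝ, Model n m) 𝓘(ℝ, Model n m) φ' u X : Model n m).1 = 0 := by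
  have hp : φ u ∈ (φ.symm ≫ₕ φ').source := by
    simp [hu, hu']
  have h := IsFibredManifold.fst_fderiv_vertical φ hφ φ' hφ' (φ u) hp
    (mfderiv 𝓘(ℝ, Model n m) 𝓘(ℝ, Model n m) φ u X : Model n m).2
  have hw : ((0, (mfderiv 𝓘(ℝ, Model n m) 𝓘(ℝ, Model n m) φ u X : Model n m).2) : Model n m) =
      mfderiv 𝓘(ℝ, Model n m) 𝓘(ℝ, Model n m) φ u X := Prod.ext hX.symm rfl
  rw [hw] at h
  -- Chain rule through the transition map: `dφ' = d(φ' ∘ φ⁻¹) ∘ dφ`, and the transition derivative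
  -- sends `(0, w)` to a vector without `x`-component.
  have hcomp : mfderiv 𝓘(ℝ, Model n m) 𝓘(ℝ, Model n m) (φ' ∘ φ.symm) (φ u) =
      (mfderiv 𝓘(ℝ, Model n m) 𝓘(ℝ, Model n m) φ' (φ.symm (φ u))).comp
        (mfderiv 𝓘(ℝ, Model n m) 𝓘(ℝ, Model n m) φ.symm (φ u)) :=
    mfderiv_comp (φ u)
      ((mdifferentiable_of_mem_atlas hφ').mdifferentiableAt (by rwa [φ.left_inv hu]))
      ((mdifferentiable_of_mem_atlas hφ).mdifferentiableAt_symm (φ.map_source hu))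
  rw [φ.left_inv hu] at hcomp
  rw [mfderiv_eq_fderiv] at hcomp
  have key : fderiv ℝ (φ' ∘ φ.symm) (φ u) (mfderiv 𝓘(ℝ, Model n m) 𝓘(ℝ, Model n m) φ u X) =
      mfderiv 𝓘(ℝ, Model n m) 𝓘(ℝ, Model n m) φ' u X :=
    (DFunLike.congr_fun hcomp _).trans
      (congrArg (mfderiv 𝓘(ℝ, Model n m) 𝓘(ℝ, Model n m) φ' u) (mfderiv_symm_mfderiv hφ hu X))
  exact (congrArg Prod.fst key).symm.trans h

/-- The vertical subspace can be computed in any chart of the atlas. -/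
theorem mem_vertical_iff (hφ : φ ∈ atlas (Model n m) V) (hu : u ∈ φ.source)
    {X : TangentSpace 𝓘(ℝ, Model n m) u} :
    X ∈ vertical n m u ↔ ∀ i, coordDX φ i u X = 0 := by
  have hiff : (mfderiv 𝓘(ℝ, Model n m) 𝓘(ℝ, Model n m) φ u X : Model n m).1 = 0 ↔
      ∀ i, coordDX φ i u X = 0 :=
    ⟨fun h i ↦ congrArg (fun w : EuclideanSpace ℝ (Fin n) ↦ w i) h, fun h ↦ by ext i; exact h i⟩
  rw [← hiff]
  exact ⟨fun h ↦ fst_mfderiv_eq_zero (chart_mem_atlas _ u) hφ (mem_chart_source _ u) hu h,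
    fun h ↦ fst_mfderiv_eq_zero hφ (chart_mem_atlas _ u) hu (mem_chart_source _ u) h⟩

/-! ### N-elongated differentials -/

variable {N : NConnection n m V}

theorem coordY_mem_vertical (hφ : φ ∈ atlas (Model n m) V) (hu : u ∈ φ.source) (a : Fin m) :
    coordY φ a u ∈ vertical n m u :=
  (mem_vertical_iff hφ hu).2 fun i ↦ coordDX_coordY hφ hu i a

/-- The coframe component `δyᵃ` of a vector is the `y`-component of its vertical part. -/
theorem NConnection.coframe_inr_apply (hφ : φ ∈ atlas (Model n m) V) (hu : u ∈ φ.source)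
    (a : Fin m) (X : TangentSpace 𝓘(ℝ, Model n m) u) :
    N.coframe φ (.inr a) u X = coordDY φ a u (N.toFun u X) := by
  -- `N` sends `∂/∂xⁱ` to `Nᵢᵃ ∂/∂yᵃ` and fixes `∂/∂yᵃ`, so the `y`-component of `N X` is `dyᵃ(X) +
  -- Nᵢᵃ dxⁱ(X)`.
  conv_rhs => rw [← sum_coordD_smul_coord hφ hu X]
  simp only [map_add, map_sum, map_smul, N.apply_vertical u _ (coordY_mem_vertical hφ hu _),
    coordDY_coordY hφ hu]
  simp [NConnection.coframe, NConnection.coeff, add_comm, mul_comm]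

theorem NConnection.vDifferential_of_horizontal (hφ : φ ∈ atlas (Model n m) V)
    (hu : u ∈ φ.source) (f : V → ℂ) {X : TangentSpace 𝓘(ℝ, Model n m) u}
    (hX : N.toFun u X = 0) : N.vDifferential φ f u X = 0 := by
  simp [NConnection.vDifferential, N.coframe_inr_apply hφ hu, hX]

theorem NConnection.hDifferential_of_vertical (hφ : φ ∈ atlas (Model n m) V)
    (hu : u ∈ φ.source) (f : V → ℂ) {X : TangentSpace 𝓘(ℝ, Model n m) u}
    (hX : X ∈ vertical n m u) : N.hDifferential φ f u X = 0 := by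
  simp [NConnection.hDifferential, NConnection.coframe, (mem_vertical_iff hφ hu).1 hX]

/-- The N-elongated h- and v-differentials add up to the differential of the function. -/
theorem NConnection.hDifferential_add_vDifferential_apply (hφ : φ ∈ atlas (Model n m) V)
    (hu : u ∈ φ.source) (f : V → ℂ) (X : TangentSpace 𝓘(ℝ, Model n m) u) :
    N.hDifferential φ f u X + N.vDifferential φ f u X = lieDeriv f u X := by
  let L : TangentSpace 𝓘(ℝ, Model n m) u →L[ℝ] ℂ := mfderiv 𝓘(ℝ, Model n m) 𝓘(ℝ, ℂ) f u
  have hL : ∀ Y, lieDeriv f u Y = L Y := fun _ ↦ rfl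
  conv_rhs => rw [← sum_coordD_smul_coord hφ hu X]
  simp only [hL, map_add, map_sum, map_smul, NConnection.hDifferential,
    NConnection.vDifferential, NConnection.coframe, NConnection.partialDeriv,
    sum_apply, ContinuousLinearMap.smulRight_apply, add_apply,
    smul_sub, Finset.sum_sub_distrib, add_smul, Finset.sum_add_distrib, Finset.sum_smul,
    Finset.smul_sum, smul_apply, smul_smul, smul_eq_mul]
  -- The term `-Nᵢᵃ dxⁱ ∂f/∂yᵃ` of the h-part and the term `+Nᵢᵃ dxⁱ ∂f/∂yᵃ` of the v-part cancel
  -- once the double sums run in the same order.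
  rw [Finset.sum_comm (s := (Finset.univ : Finset (Fin m)))]
  simp only [mul_comm (N.coeff φ _ _ u)]
  abel

theorem NConnection.differential_apply (f : V → ℂ) (X : TangentSpace 𝓘(ℝ, Model n m) u) :
    N.differential f u X = lieDeriv f u X :=
  N.hDifferential_add_vDifferential_apply (chart_mem_atlas _ u) (mem_chart_source _ u) f X

end Charts

/-- The product rule for the multiple of a complex vector-valued function by a complex function. -/
theorem lieDeriv_smul {n m : ℕ} {V : Type*} [TopologicalSpace V] [ChartedSpace (Model n m) V]
    {W : Type*} [NormedAddCommGroup W] [NormedSpace ℝ W] [NormedSpace ℂ W] [IsScalarTower ℝ ℂ W]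
    {f : V → ℂ} {F : V → W} {u : V}
    (hf : MDifferentiableAt 𝓘(ℝ, Model n m) 𝓘(ℝ, ℂ) f u)
    (hF : MDifferentiableAt 𝓘(ℝ, Model n m) 𝓘(ℝ, W) F u)
    (X : TangentSpace 𝓘(ℝ, Model n m) u) :
    lieDeriv (fun v ↦ f v • F v) u X = f u • lieDeriv F u X + lieDeriv f u X • F u := by
  let f' : Model n m →L[ℝ] ℂ := mfderiv 𝓘(ℝ, Model n m) 𝓘(ℝ, ℂ) f u
  let F' : Model n m →L[ℝ] W := mfderiv 𝓘(ℝ, Model n m) 𝓘(ℝ, W) F u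
  have h : HasMFDerivAt 𝓘(ℝ, Model n m) 𝓘(ℝ, W) (fun v ↦ f v • F v) u
      (f u • F' + f'.smulRight (F u)) := by
    -- The manifold derivative is by definition a Fréchet derivative in the extended chart, so the
    -- ordinary product rule applies there.
    have hf₁ : HasFDerivWithinAt (f ∘ (extChartAt 𝓘(ℝ, Model n m) u).symm) f'
        (range 𝓘(ℝ, Model n m)) (extChartAt 𝓘(ℝ, Model n m) u u) := hf.hasMFDerivAt.2
    have hF₁ : HasFDerivWithinAt (F ∘ (extChartAt 𝓘(ℝ, Model n m) u).symm) F'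
        (range 𝓘(ℝ, Model n m)) (extChartAt 𝓘(ℝ, Model n m) u u) := hF.hasMFDerivAt.2
    have h₁ := hf₁.smul hF₁
    rw [Function.comp_apply, Function.comp_apply, extChartAt_to_inv] at h₁
    exact ⟨hf.hasMFDerivAt.1.smul hF.hasMFDerivAt.1, h₁⟩
  exact DFunLike.congr_fun h.mfderiv X

/-! ### Leibniz rule and commutators on spinor fields -/

namespace SpinStructure

variable {n m : ℕ} {V : Type*} [TopologicalSpace V] [ChartedSpace (Model n m) V]
  [IsFibredManifold n m V] {N : NConnection n m V} {g : DMetric N} {ι : Type*}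
  {σ : SpinStructure g ι} {f : V → ℂ} {ψ : ∀ u : V, σ.Fiber u} {u : V}

/-- The change of frame is complex-linear in each fibre. -/
theorem localRep_smul (κ : ι) :
    σ.localRep κ (fun v ↦ f v • ψ v) = fun v ↦ f v • σ.localRep κ ψ v :=
  funext fun v ↦ map_smul (σ.transition (σ.indexAt v) κ v) (f v) (ψ v)

theorem localRep_indexAt : σ.localRep (σ.indexAt u) ψ u = σ.components (ψ u) :=
  DFunLike.congr_fun (σ.transition_self _ u (σ.mem_baseSet_at u)) (ψ u)

/-- Smoothness at `u` is tested in the preferred trivialization there, which is the one of the frame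
`indexAt u`. -/
theorem IsSmoothSection.mdifferentiableAt_localRep (hψ : σ.IsSmoothSection ψ) :
    MDifferentiableAt 𝓘(ℝ, Model n m) 𝓘(ℝ, Spinor n m) (σ.localRep (σ.indexAt u) ψ) u :=
  ((contMDiffAt_totalSpace.1 (hψ u)).2).mdifferentiableAt (by simp)

/-- The Leibniz rule for the canonical spin d-connection. -/
theorem spinDConnection_smul (hf : MDifferentiableAt 𝓘(ℝ, Model n m) 𝓘(ℝ, ℂ) f u)
    (hψ : σ.IsSmoothSection ψ) (X : TangentSpace 𝓘(ℝ, Model n m) u) :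
    σ.spinDConnection (fun v ↦ f v • ψ v) u X =
      f u • σ.spinDConnection ψ u X + lieDeriv f u X • ψ u := by
  have h := lieDeriv_smul hf (hψ.mdifferentiableAt_localRep (u := u)) X
  rw [localRep_indexAt] at h
  unfold spinDConnection
  rw [localRep_smul, h]
  -- Moving `f u` past `1/4`, the connection coefficients and the gamma matrices makes the
  -- zeroth-order terms agree.
  simp only [map_add, map_smul, LinearEquiv.symm_apply_apply, smul_sub, Finset.smul_sum,
    smul_comm (f u)]
  abel

/-- The gamma matrices are complex-linear, so the part `f ∇^S ψ` of the Leibniz rule cancels against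
`f` times the operator. -/
theorem commutator_diracH (hf : MDifferentiableAt 𝓘(ℝ, Model n m) 𝓘(ℝ, ℂ) f u)
    (hψ : σ.IsSmoothSection ψ) :
    commutator σ.diracH f ψ u =
      -Complex.I • σ.contractH fun X ↦ lieDeriv f u X • ψ u := by
  simp only [commutator, diracH, contractH, spinDConnection_smul hf hψ, map_add, map_smul,
    Finset.sum_add_distrib, ← Finset.smul_sum, smul_add, smul_comm (f u), add_sub_cancel_left]

theorem commutator_diracV (hf : MDifferentiableAt 𝓘(ℝ, Model n m) 𝓘(ℝ, ℂ) f u)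
    (hψ : σ.IsSmoothSection ψ) :
    commutator σ.diracV f ψ u =
      -Complex.I • σ.contractV fun X ↦ lieDeriv f u X • ψ u := by
  simp only [commutator, diracV, contractV, spinDConnection_smul hf hψ, map_add, map_smul,
    Finset.sum_add_distrib, ← Finset.smul_sum, smul_add, smul_comm (f u), add_sub_cancel_left]

theorem commutator_dirac (hf : MDifferentiableAt 𝓘(ℝ, Model n m) 𝓘(ℝ, ℂ) f u)
    (hψ : σ.IsSmoothSection ψ) :
    commutator σ.dirac f ψ u =
      -Complex.I • σ.contract fun X ↦ lieDeriv f u X • ψ u := by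
  simp only [commutator, dirac, contract, spinDConnection_smul hf hψ, map_add, map_smul,
    Finset.sum_add_distrib, ← Finset.smul_sum, smul_add, smul_comm (f u), add_sub_cancel_left]

/-! ### Elongated differentials on the adapted orthonormal frame -/

variable {φ : OpenPartialHomeomorph V (Model n m)}

theorem hDifferential_frameAt (hφ : φ ∈ atlas (Model n m) V) (hu : u ∈ φ.source) (f : V → ℂ)
    (i : Fin n) :
    N.hDifferential φ f u (σ.frameAt u (.inl i)) = lieDeriv f u (σ.frameAt u (.inl i)) := by
  have h := N.vDifferential_of_horizontal hφ hu f
    (X := σ.frameAt u (.inl i)) (σ.horizontal_frame _ u (σ.mem_baseSet_at u) i)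
  rw [← N.hDifferential_add_vDifferential_apply hφ hu f, h, add_zero]

theorem vDifferential_frameAt (hφ : φ ∈ atlas (Model n m) V) (hu : u ∈ φ.source) (f : V → ℂ)
    (a : Fin m) :
    N.vDifferential φ f u (σ.frameAt u (.inr a)) = lieDeriv f u (σ.frameAt u (.inr a)) := by
  have h := N.hDifferential_of_vertical hφ hu f
    (X := σ.frameAt u (.inr a)) (σ.vertical_frame _ u (σ.mem_baseSet_at u) a)
  rw [← N.hDifferential_add_vDifferential_apply hφ hu f, h, zero_add]

end SpinStructure

end NAnholonomic

end

open NAnholonomic in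
theorem mainTheorem7 {n m : ℕ} {V : Type*} [TopologicalSpace V] [ChartedSpace (Model n m) V]
    [IsFibredManifold n m V] {N : NConnection n m V} {g : DMetric N} {ι : Type*}
    (σ : SpinStructure g ι) (f : V → ℂ) (hf : ContMDiff 𝓘(ℝ, Model n m) 𝓘(ℝ, ℂ) ∞ f)
    (ψ : ∀ u : V, σ.Fiber u) (hψ : σ.IsSmoothSection ψ) :
    (∀ u : V, SpinStructure.commutator σ.dirac f ψ u =
      -Complex.I • σ.clifford (N.differential f u) (ψ u)) ∧
    (∀ φ ∈ atlas (Model n m) V, ∀ u ∈ φ.source,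
      SpinStructure.commutator σ.diracH f ψ u + SpinStructure.commutator σ.diracV f ψ u =
        -Complex.I • σ.cliffordH (N.hDifferential φ f u) (ψ u)
          + -Complex.I • σ.cliffordV (N.vDifferential φ f u) (ψ u)) := by
  have hf' : ∀ u, MDifferentiableAt 𝓘(ℝ, Model n m) 𝓘(ℝ, ℂ) f u :=
    fun u ↦ (hf u).mdifferentiableAt (by simp)
  refine ⟨fun u ↦ ?_, fun φ hφ u hu ↦ ?_⟩
  -- Both sides become contractions of `X ↦ a(X) ψ`, with `a = df` and `a = δf`, and these covectors
  -- coincide.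
  · rw [SpinStructure.commutator_dirac (hf' u) hψ, ← SpinStructure.contract_tmul]
    simp only [NConnection.differential_apply]
  · rw [SpinStructure.commutator_diracH (hf' u) hψ, SpinStructure.commutator_diracV (hf' u) hψ]
    -- Only values on frame vectors enter, so the elongated differentials may be replaced by `df`
    -- although they differ from it as covectors in general.
    simp only [SpinStructure.contractH, SpinStructure.contractV, SpinStructure.cliffordH,
      SpinStructure.cliffordV, LinearMap.sum_apply, LinearMap.smul_apply, map_smul,
      SpinStructure.hDifferential_frameAt hφ hu, SpinStructure.vDifferential_frameAt hφ hu]
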